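/- Let $\mathbf{Trans}$ be the following graphical language. Its objects are finite sets. Its diagrams are built from a box $\underline{R}\colon A\to B$ for each relation $R\subseteq A\times B$ between finite sets, identities $\mathrm{id}_A$ and swaps $\gamma_{A,B}\colon A\times B\to B\times A$, by sequential composition $d\mathbin{;}e$ (first $d$, then $e$), parallel composition $d\times e$, and feedback: a diagram $d\colon A\times Q\to B\times Q$ and subsets $I,F\subseteq Q$ of a finite set $Q$ give $\mathrm{fb}^{I,F}_Q(d)\colon A\to B$. A diagram $d\colon A\to B$ denotes a length-preserving relation $[\![d]\!]\subseteq A^*\times B^*$, where a word over $A\times C$ is identified with a pair of words of the same length over $A$ and $C$. The box $\underline{R}$ denotes the letterwise lift of $R$ (words of the same length, related letter by letter by $R$); identities, swaps, $;$ and $\times$ denote identities, letterwise swaps, composition and product of relations; and $w\,[\![\mathrm{fb}^{I,F}_Q(d)]\!]\,v$, for words of length $n\ge 0$, iff there are $q_0,\dots,q_n\in Q$ with $q_0\in I$, $q_n\in F$ and $(w,q_0\cdots q_{n-1})\,[\![d]\!]\,(v,q_1\cdots q_n)$. (The relations so obtained are the regular relations, i.e. the behaviours of finite transducers.) Provable equality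 is the least congruence on diagrams with the same source and target which contains, modulo the canonical identifications $(A\times B)\times C=A\times(B\times C)$ and $\mathbb 1\times A=A=A\times\mathbb 1$ (with $\mathbb 1$ a one-point set): 1. the equations of a symmetric monoidal category; 2. the equations of a feedback category: $\mathrm{fb}^{I,F}_Q\big((d\times\mathrm{id}_Q);e;(f\times\mathrm{id}_Q)\big)=d;\mathrm{fb}^{I,F}_Q(e);f$; $\ \mathrm{fb}^{I,F}_Q(\mathrm{id}_C\times d)=\mathrm{id}_C\times\mathrm{fb}^{I,F}_Q(d)$; $\ \mathrm{fb}^{\mathbb 1,\mathbb 1}_{\mathbb 1}(d)=d$; $\ \mathrm{fb}^{I,F}_P(\mathrm{fb}^{J,G}_Q(d))=\mathrm{fb}^{I\times J,F\times G}_{P\times Q}(d)$; 3. the equations embedding finite sets and relations: boxes of identities and of swaps are the identities and swaps, $\underline{R};\underline{S}=\underline{R;S}$ and $\underline{R}\times\underline{S}=\underline{R\times S}$; 4. the simulation principle: for relations $R\colon A\times P\to B\times P$, $T\colon A\times Q\to B\times Q$, $S\colon P\to Q$ between finite sets and $I,F\subseteq P$, $J,G\subseteq Q$, if $J=\{q\mid\exists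 p\in I,\ p\,S\,q\}$, $R;(\mathrm{id}_B\times S)=(\mathrm{id}_A\times S);T$ and $F=\{p\mid\exists q\in G,\ p\,S\,q\}$, then $\mathrm{fb}^{I,F}_P(\underline{R})=\mathrm{fb}^{J,G}_Q(\underline{T})$. Theorem (completeness for finite words). For all finite sets $A,B$ and all diagrams $d,e\colon A\to B$ of $\mathbf{Trans}$, if $[\![d]\!]=[\![e]\!]$, then $d$ and $e$ are provably equal. -/

import Mathlib

universe u

/-- The product of two relations, `R × S`. -/
def relProd {A B C D : Type u} (R : A → B → Prop) (S : C → D → Prop) :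
    A × C → B × D → Prop :=
  fun x y => R x.1 y.1 ∧ S x.2 y.2

/-- Diagrams of the graphical language for transducers on finite words. The objects are finite
sets. The generators are one box for each relation between finite sets, wires and wire crossings;
diagrams are composed sequentially (in diagrammatic order) and in parallel, and a wire `Q` may be
fed back with a set `I ⊆ Q` of initial and a set `F ⊆ Q` of final states. -/
inductive TransDiag : Type u → Type u → Type (u + 1)
  | box {A B : Type u} [Finite A] [Finite B] (R : A → B → Prop) : TransDiag A B
  | id (A : Type u) [Finite A] : TransDiag A A
  | swap (A B : Type u) [Finite A] [Finite B] : TransDiag (A × B) (B × A)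
  | comp {A B C : Type u} [Finite A] [Finite B] [Finite C]
      (d : TransDiag A B) (e : TransDiag B C) : TransDiag A C
  | tensor {A B C D : Type u} [Finite A] [Finite B] [Finite C] [Finite D]
      (d : TransDiag A B) (e : TransDiag C D) : TransDiag (A × C) (B × D)
  | feedback {A B Q : Type u} [Finite A] [Finite B] [Finite Q] (I F : Set Q)
      (d : TransDiag (A × Q) (B × Q)) : TransDiag A B

namespace TransDiag

/-- The shift relation `shift I F` on words over `Q`: it relates `q₁ … qₙ` to `q₀ … qₙ₋₁`
whenever `q₀ ∈ I` and `qₙ ∈ F`. On empty words (`n = 0`) it holds iff `I ∩ F` is non-empty. -/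
def shift {Q : Type u} (I F : Set Q) (t s : List Q) : Prop :=
  ∃ q₀ ∈ I, ∃ qₙ ∈ F, q₀ :: t = s ++ [qₙ]

/-- The semantics: a diagram from `A` to `B` denotes a relation between `A*` and `B*`.
All these relations only relate words of the same length, see `length_eq_of_sem`, and so a word
over `A × C` is the same as a pair of words of the same length over `A` and over `C`. -/
def sem {A B : Type u} (d : TransDiag A B) : List A → List B → Prop :=
  match d with
  | box R => List.Forall₂ R
  | id _ => fun w v => w = v
  | swap _ _ => fun w v => w.map Prod.swap = v
  | comp d e => Relation.Comp (sem d) (sem e)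
  | tensor d e => fun w v =>
      sem d (w.map Prod.fst) (v.map Prod.fst) ∧ sem e (w.map Prod.snd) (v.map Prod.snd)
  | feedback (A := A) (B := B) (Q := Q) I F d => fun w v =>
      ∃ (x : List (A × Q)) (y : List (B × Q)), x.map Prod.fst = w ∧ y.map Prod.fst = v ∧
        sem d x y ∧ shift I F (y.map Prod.snd) (x.map Prod.snd)

theorem length_eq_of_sem {A B : Type u} (d : TransDiag A B) (w : List A) (v : List B)
    (h : sem d w v) : w.length = v.length := by
  induction d with
  | box R => exact List.Forall₂.length_eq h
  | id _ => exact congrArg List.length h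
  | swap _ _ => subst h; simp
  | comp d e ihd ihe =>
    obtain ⟨z, h₁, h₂⟩ := h
    exact (ihd _ _ h₁).trans (ihe _ _ h₂)
  | tensor d e ihd _ => simpa using ihd _ _ h.1
  | feedback I F d ih =>
    obtain ⟨x, y, rfl, rfl, h, -⟩ := h
    simpa using ih _ _ h

/-- The box of a bijection. The boxes of the canonical bijections `(A × B) × C ≃ A × (B × C)`,
`1 × A ≃ A` and `A × 1 ≃ A` below make explicit the identification of these sets, which is left
implicit when the cartesian product is treated as strictly associative and unital. -/
def iso {A B : Type u} [Finite A] [Finite B] (f : A ≃ B) : TransDiag A B :=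
  box (fun a b => f a = b)

/-- The identification of `(A × B) × C` with `A × (B × C)`. -/
def assoc (A B C : Type u) [Finite A] [Finite B] [Finite C] :
    TransDiag ((A × B) × C) (A × (B × C)) :=
  iso (Equiv.prodAssoc A B C)

/-- The identification of `A × (B × C)` with `(A × B) × C`. -/
def assocInv (A B C : Type u) [Finite A] [Finite B] [Finite C] :
    TransDiag (A × (B × C)) ((A × B) × C) :=
  iso (Equiv.prodAssoc A B C).symm

/-- The identification of `1 × A` with `A`. -/
def leftUnit (A : Type u) [Finite A] : TransDiag (PUnit.{u + 1} × A) A :=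
  iso (Equiv.punitProd A)

/-- The identification of `A × 1` with `A`. -/
def rightUnit (A : Type u) [Finite A] : TransDiag (A × PUnit.{u + 1}) A :=
  iso (Equiv.prodPUnit A)

/-- The identification of `A` with `A × 1`. -/
def rightUnitInv (A : Type u) [Finite A] : TransDiag A (A × PUnit.{u + 1}) :=
  iso (Equiv.prodPUnit A).symm

/-- Provable equality of diagrams: the least congruence that contains the equations of a
symmetric monoidal category, those of a feedback category, those that embed finite sets and
relations, and the simulation principle. -/
inductive ProvEq : {A B : Type u} → TransDiag A B → TransDiag A B → Prop
  -- congruence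
  | refl {A B : Type u} (d : TransDiag A B) : ProvEq d d
  | symm {A B : Type u} {d e : TransDiag A B} : ProvEq d e → ProvEq e d
  | trans {A B : Type u} {d e f : TransDiag A B} : ProvEq d e → ProvEq e f → ProvEq d f
  | comp_congr {A B C : Type u} [Finite A] [Finite B] [Finite C]
      {d d' : TransDiag A B} {e e' : TransDiag B C} :
      ProvEq d d' → ProvEq e e' → ProvEq (comp d e) (comp d' e')
  | tensor_congr {A B C D : Type u} [Finite A] [Finite B] [Finite C] [Finite D]
      {d d' : TransDiag A B} {e e' : TransDiag C D} :
      ProvEq d d' → ProvEq e e' → ProvEq (tensor d e) (tensor d' e')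
  | feedback_congr {A B Q : Type u} [Finite A] [Finite B] [Finite Q] (I F : Set Q)
      {d d' : TransDiag (A × Q) (B × Q)} :
      ProvEq d d' → ProvEq (feedback I F d) (feedback I F d')
  -- symmetric monoidal category
  | id_comp {A B : Type u} [Finite A] [Finite B] (d : TransDiag A B) : ProvEq (comp (id A) d) d
  | comp_id {A B : Type u} [Finite A] [Finite B] (d : TransDiag A B) : ProvEq (comp d (id B)) d
  | comp_assoc {A B C D : Type u} [Finite A] [Finite B] [Finite C] [Finite D]
      (d : TransDiag A B) (e : TransDiag B C) (f : TransDiag C D) :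
      ProvEq (comp (comp d e) f) (comp d (comp e f))
  | tensor_id (A B : Type u) [Finite A] [Finite B] :
      ProvEq (tensor (id A) (id B)) (id (A × B))
  | tensor_comp {A B C A' B' C' : Type u} [Finite A] [Finite B] [Finite C]
      [Finite A'] [Finite B'] [Finite C']
      (d : TransDiag A B) (e : TransDiag B C) (d' : TransDiag A' B') (e' : TransDiag B' C') :
      ProvEq (tensor (comp d e) (comp d' e')) (comp (tensor d d') (tensor e e'))
  | tensor_assoc {A B C A' B' C' : Type u} [Finite A] [Finite B] [Finite C]
      [Finite A'] [Finite B'] [Finite C']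
      (d : TransDiag A A') (e : TransDiag B B') (f : TransDiag C C') :
      ProvEq (comp (tensor (tensor d e) f) (assoc A' B' C'))
        (comp (assoc A B C) (tensor d (tensor e f)))
  | unit_tensor {A B : Type u} [Finite A] [Finite B] (d : TransDiag A B) :
      ProvEq (comp (tensor (id PUnit.{u + 1}) d) (leftUnit B)) (comp (leftUnit A) d)
  | tensor_unit {A B : Type u} [Finite A] [Finite B] (d : TransDiag A B) :
      ProvEq (comp (tensor d (id PUnit.{u + 1})) (rightUnit B)) (comp (rightUnit A) d)
  | swap_swap (A B : Type u) [Finite A] [Finite B] :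
      ProvEq (comp (swap A B) (swap B A)) (id (A × B))
  | swap_natural {A B C D : Type u} [Finite A] [Finite B] [Finite C] [Finite D]
      (d : TransDiag A B) (e : TransDiag C D) :
      ProvEq (comp (tensor d e) (swap B D)) (comp (swap A C) (tensor e d))
  -- feedback category: tightening, strength, vanishing, joining
  | tightening {A A' B B' Q : Type u} [Finite A] [Finite A'] [Finite B] [Finite B'] [Finite Q]
      (I F : Set Q) (d : TransDiag A' A) (e : TransDiag (A × Q) (B × Q)) (f : TransDiag B B') :
      ProvEq (feedback I F (comp (comp (tensor d (id Q)) e) (tensor f (id Q))))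
        (comp (comp d (feedback I F e)) f)
  | strength {A B C Q : Type u} [Finite A] [Finite B] [Finite C] [Finite Q]
      (I F : Set Q) (d : TransDiag (A × Q) (B × Q)) :
      ProvEq
        (feedback I F (comp (comp (assoc C A Q) (tensor (id C) d)) (assocInv C B Q)))
        (tensor (id C) (feedback I F d))
  | vanishing {A B : Type u} [Finite A] [Finite B]
      (d : TransDiag (A × PUnit.{u + 1}) (B × PUnit.{u + 1})) :
      ProvEq (feedback Set.univ Set.univ d)
        (comp (comp (rightUnitInv A) d) (rightUnit B))
  | joining {A B P Q : Type u} [Finite A] [Finite B] [Finite P] [Finite Q]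
      (I F : Set P) (J G : Set Q) (d : TransDiag ((A × P) × Q) ((B × P) × Q)) :
      ProvEq (feedback I F (feedback J G d))
        (feedback (I ×ˢ J) (F ×ˢ G) (comp (comp (assocInv A P Q) d) (assoc B P Q)))
  -- embedding of finite sets and relations
  | box_id (A : Type u) [Finite A] : ProvEq (box (fun a a' : A => a = a')) (id A)
  | box_swap (A B : Type u) [Finite A] [Finite B] :
      ProvEq (box (fun (x : A × B) (y : B × A) => x.swap = y)) (swap A B)
  | box_comp {A B C : Type u} [Finite A] [Finite B] [Finite C]
      (R : A → B → Prop) (S : B → C → Prop) :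
      ProvEq (comp (box R) (box S)) (box (Relation.Comp R S))
  | box_tensor {A B C D : Type u} [Finite A] [Finite B] [Finite C] [Finite D]
      (R : A → B → Prop) (S : C → D → Prop) :
      ProvEq (tensor (box R) (box S)) (box (relProd R S))
  -- simulation principle: the premises are equations between relations on finite sets
  | simulation {A B P Q : Type u} [Finite A] [Finite B] [Finite P] [Finite Q]
      (R : A × P → B × P → Prop) (I F : Set P) (T : A × Q → B × Q → Prop) (J G : Set Q)
      (S : P → Q → Prop)
      (hinit : {q | ∃ p ∈ I, S p q} = J)
      (hstep : Relation.Comp R (relProd (fun b b' : B => b = b') S) =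
        Relation.Comp (relProd (fun a a' : A => a = a') S) T)
      (hfinal : F = {p | ∃ q ∈ G, S p q}) :
      ProvEq (feedback I F (box R)) (feedback J G (box T))

end TransDiag

/-! By the feedback equations every diagram is provably a single loop around a box
(`hasNormalForm`). Such a loop is a nondeterministic finite automaton over the alphabet `A × B`,
since a pair of words of equal length is a word of pairs, and its semantics is the accepted
language.

For two such automata, run both subset constructions in parallel and keep only the reachable pairs
of subsets. With the final states taken from either side, the result is deterministic and simulates
that side by membership of a state in a subset (`provEq_of_deterministic`). If the languages agree,
the two sets of final states coincide on reachable pairs, so one automaton is provably equal to both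
loops (`provEq_feedback_box`). Soundness (`ProvEq.sound`) carries the semantic hypothesis from the
given diagrams to their normal forms. -/

theorem List.ext_map_fst_snd {A C : Type u} {x y : List (A × C)}
    (h₁ : x.map Prod.fst = y.map Prod.fst) (h₂ : x.map Prod.snd = y.map Prod.snd) : x = y := by
  rw [← List.zip_unzip x, ← List.zip_unzip y]
  simp [List.unzip_fst, List.unzip_snd, h₁, h₂]

theorem List.exists_map_fst_snd {A C : Type u} {w : List A} {s : List C}
    (h : w.length = s.length) :
    ∃ x : List (A × C), x.map Prod.fst = w ∧ x.map Prod.snd = s :=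
  ⟨w.zip s, List.map_fst_zip h.le, List.map_snd_zip h.ge⟩

theorem List.forall₂_graph_iff {A B : Type u} (f : A → B) (w : List A) (v : List B) :
    List.Forall₂ (fun a b => f a = b) w v ↔ w.map f = v := by
  rw [← List.forall₂_eq_eq_eq, List.forall₂_map_left_iff]

theorem List.forall₂_comp_iff {A B C : Type u} (R : A → B → Prop) (S : B → C → Prop)
    (w : List A) (v : List C) :
    List.Forall₂ (Relation.Comp R S) w v ↔ ∃ z, List.Forall₂ R w z ∧ List.Forall₂ S z v := by
  constructor
  · intro h
    induction h with
    | nil => exact ⟨[], .nil, .nil⟩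
    | cons h _ ih =>
      obtain ⟨b, hR, hS⟩ := h
      obtain ⟨z, h₁, h₂⟩ := ih
      exact ⟨b :: z, .cons hR h₁, .cons hS h₂⟩
  · rintro ⟨z, h₁, h₂⟩
    induction h₁ generalizing v with
    | nil => cases h₂; exact .nil
    | cons h _ ih =>
      cases h₂ with
      | cons h' h₂ => exact .cons ⟨_, h, h'⟩ (ih _ h₂)

theorem List.forall₂_relProd_iff {A B C D : Type u} (R : A → B → Prop) (S : C → D → Prop)
    (w : List (A × C)) (v : List (B × D)) :
    List.Forall₂ (relProd R S) w v ↔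
      List.Forall₂ R (w.map Prod.fst) (v.map Prod.fst) ∧
        List.Forall₂ S (w.map Prod.snd) (v.map Prod.snd) := by
  induction w generalizing v with
  | nil => cases v <;> simp
  | cons a w ih =>
    cases v with
    | nil => simp
    | cons b v => simp only [List.map_cons, List.forall₂_cons, ih, relProd]; tauto

/-! ### Semantics of the structural and feedback equations -/

namespace TransDiag

theorem shift_length {Q : Type u} {I F : Set Q} {t s : List Q} (h : shift I F t s) :
    t.length = s.length := by
  obtain ⟨q, -, q', -, h⟩ := h
  simpa using congrArg List.length h

theorem shift_prod_iff {P Q : Type u} (I F : Set P) (J G : Set Q) (t s : List (P × Q)) :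
    shift (I ×ˢ J) (F ×ˢ G) t s ↔
      shift I F (t.map Prod.fst) (s.map Prod.fst) ∧
        shift J G (t.map Prod.snd) (s.map Prod.snd) := by
  constructor
  · rintro ⟨q, hq, q', hq', h⟩
    exact ⟨⟨q.1, hq.1, q'.1, hq'.1, by simpa using congrArg (List.map Prod.fst) h⟩,
      ⟨q.2, hq.2, q'.2, hq'.2, by simpa using congrArg (List.map Prod.snd) h⟩⟩
  · rintro ⟨⟨p, hp, p', hp', h⟩, q, hq, q', hq', h'⟩
    exact ⟨(p, q), ⟨hp, hq⟩, (p', q'), ⟨hp', hq'⟩,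
      List.ext_map_fst_snd (by simpa using h) (by simpa using h')⟩

theorem shift_punit {t s : List PUnit.{u + 1}} (h : t.length = s.length) :
    shift Set.univ Set.univ t s :=
  ⟨.unit, trivial, .unit, trivial, List.ext_getElem (by simp [h]) fun _ _ _ => rfl⟩

theorem sem_iso {A B : Type u} [Finite A] [Finite B] (f : A ≃ B) (w : List A) (v : List B) :
    sem (iso f) w v ↔ w.map f = v :=
  List.forall₂_graph_iff f w v

theorem sem_iso_comp {A B C : Type u} [Finite A] [Finite B] [Finite C] (f : A ≃ B)
    (d : TransDiag B C) (w : List A) (v : List C) :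
    sem (comp (iso f) d) w v ↔ sem d (w.map f) v := by
  constructor
  · rintro ⟨z, h₁, h₂⟩
    rwa [(sem_iso f w z).1 h₁]
  · exact fun h => ⟨_, (sem_iso f _ _).2 rfl, h⟩

theorem sem_comp_iso {A B C : Type u} [Finite A] [Finite B] [Finite C] (f : B ≃ C)
    (d : TransDiag A B) (w : List A) (v : List C) :
    sem (comp d (iso f)) w v ↔ sem d w (v.map f.symm) := by
  constructor
  · rintro ⟨z, h₁, h₂⟩
    rw [sem_iso] at h₂
    subst h₂
    simpa using h₁
  · exact fun h => ⟨_, h, (sem_iso f _ _).2 (by simp)⟩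

theorem sem_tensor {A B C D : Type u} [Finite A] [Finite B] [Finite C] [Finite D]
    (d : TransDiag A B) (e : TransDiag C D) (w : List (A × C)) (v : List (B × D)) :
    sem (tensor d e) w v ↔
      sem d (w.map Prod.fst) (v.map Prod.fst) ∧ sem e (w.map Prod.snd) (v.map Prod.snd) :=
  Iff.rfl

theorem sem_feedback {A B Q : Type u} [Finite A] [Finite B] [Finite Q] (I F : Set Q)
    (d : TransDiag (A × Q) (B × Q)) (w : List A) (v : List B) :
    sem (feedback I F d) w v ↔
      ∃ (x : List (A × Q)) (y : List (B × Q)), x.map Prod.fst = w ∧ y.map Prod.fst = v ∧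
        sem d x y ∧ shift I F (y.map Prod.snd) (x.map Prod.snd) :=
  Iff.rfl

theorem sem_id {A : Type u} [Finite A] (w v : List A) : sem (id A) w v ↔ w = v := Iff.rfl

theorem sem_tightening {A A' B B' Q : Type u} [Finite A] [Finite A'] [Finite B] [Finite B']
    [Finite Q] (I F : Set Q) (d : TransDiag A' A) (e : TransDiag (A × Q) (B × Q))
    (f : TransDiag B B') (w : List A') (v : List B') :
    sem (feedback I F (comp (comp (tensor d (id Q)) e) (tensor f (id Q)))) w v ↔
      sem (comp (comp d (feedback I F e)) f) w v := by
  constructor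
  · rintro ⟨x, y, rfl, rfl, ⟨z', ⟨z, ⟨hd, hz⟩, he⟩, hf, hz'⟩, hs⟩
    rw [sem_id] at hz hz'
    exact ⟨_, ⟨_, hd, z, z', rfl, rfl, he, by rwa [← hz, hz']⟩, hf⟩
  · rintro ⟨_, ⟨_, hd, z, z', rfl, rfl, he, hs⟩, hf⟩
    -- As `d` and `f` preserve length, the state words around `e` have the lengths of `w` and `v`,
    -- hence can be paired with them.
    have hd' := length_eq_of_sem _ _ _ hd
    have hf' := length_eq_of_sem _ _ _ hf
    obtain ⟨x, rfl, hx⟩ := List.exists_map_fst_snd (w := w) (s := z.map Prod.snd) (by simpa using hd')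
    obtain ⟨y, rfl, hy⟩ :=
      List.exists_map_fst_snd (w := v) (s := z'.map Prod.snd) (by simpa using hf'.symm)
    exact ⟨x, y, rfl, rfl, ⟨z', ⟨z, ⟨hd, hx⟩, he⟩, hf, hy.symm⟩, by rwa [hx, hy]⟩

theorem sem_strength {A B C Q : Type u} [Finite A] [Finite B] [Finite C] [Finite Q]
    (I F : Set Q) (d : TransDiag (A × Q) (B × Q)) (w : List (C × A)) (v : List (C × B)) :
    sem (feedback I F (comp (comp (assoc C A Q) (tensor (id C) d)) (assocInv C B Q))) w v ↔
      sem (tensor (id C) (feedback I F d)) w v := by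
  simp only [sem_feedback, sem_tensor, assoc, assocInv, sem_comp_iso, sem_iso_comp, sem_id,
    List.map_map, Equiv.symm_symm]
  constructor
  · rintro ⟨x, y, rfl, rfl, ⟨h₁, h₂⟩, hs⟩
    refine ⟨?_, _, _, ?_, ?_, h₂, ?_⟩
    · simpa [Function.comp_def] using h₁
    · simp [Function.comp_def]
    · simp [Function.comp_def]
    · simpa [Function.comp_def] using hs
  · rintro ⟨h, x, y, hx, hy, hd, hs⟩
    obtain ⟨x', rfl, hx'⟩ := List.exists_map_fst_snd (w := w) (s := x.map Prod.snd)
      (by simpa using (congrArg List.length hx).symm)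
    obtain ⟨y', rfl, hy'⟩ := List.exists_map_fst_snd (w := v) (s := y.map Prod.snd)
      (by simpa using (congrArg List.length hy).symm)
    -- The inner words of the loop are recovered from the outer ones by reassociating and forgetting
    -- `C`.
    have ex : x = x'.map (Prod.snd ∘ Equiv.prodAssoc C A Q) :=
      List.ext_map_fst_snd (by simpa [Function.comp_def] using hx)
        (by simpa [Function.comp_def] using hx'.symm)
    have ey : y = y'.map (Prod.snd ∘ Equiv.prodAssoc C B Q) :=
      List.ext_map_fst_snd (by simpa [Function.comp_def] using hy)
        (by simpa [Function.comp_def] using hy'.symm)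
    refine ⟨x', y', rfl, rfl, ⟨?_, ?_⟩, ?_⟩
    · simpa [Function.comp_def] using h
    · rwa [← ex, ← ey]
    · rwa [hx', hy']

theorem sem_vanishing {A B : Type u} [Finite A] [Finite B]
    (d : TransDiag (A × PUnit.{u + 1}) (B × PUnit.{u + 1})) (w : List A) (v : List B) :
    sem (feedback Set.univ Set.univ d) w v ↔
      sem (comp (comp (rightUnitInv A) d) (rightUnit B)) w v := by
  simp only [sem_feedback, rightUnit, rightUnitInv, sem_comp_iso, sem_iso_comp]
  constructor
  · rintro ⟨x, y, rfl, rfl, h, -⟩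
    simpa [Function.comp_def] using h
  · intro h
    refine ⟨_, _, ?_, ?_, h, shift_punit ?_⟩
    · simp [Function.comp_def]
    · simp [Function.comp_def]
    · simpa using (length_eq_of_sem _ _ _ h).symm

theorem sem_joining {A B P Q : Type u} [Finite A] [Finite B] [Finite P] [Finite Q]
    (I F : Set P) (J G : Set Q) (d : TransDiag ((A × P) × Q) ((B × P) × Q))
    (w : List A) (v : List B) :
    sem (feedback I F (feedback J G d)) w v ↔
      sem (feedback (I ×ˢ J) (F ×ˢ G) (comp (comp (assocInv A P Q) d) (assoc B P Q))) w v := by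
  simp only [sem_feedback, assoc, assocInv, sem_comp_iso, sem_iso_comp, shift_prod_iff]
  constructor
  · rintro ⟨_, _, rfl, rfl, ⟨x, y, rfl, rfl, hd, hs'⟩, hs⟩
    refine ⟨x.map (Equiv.prodAssoc A P Q), y.map (Equiv.prodAssoc B P Q), ?_, ?_, ?_, ?_, ?_⟩
    · simp [Function.comp_def]
    · simp [Function.comp_def]
    · simpa [Function.comp_def] using hd
    · simpa [Function.comp_def] using hs
    · simpa [Function.comp_def] using hs'
  · rintro ⟨x, y, rfl, rfl, hd, hs, hs'⟩
    refine ⟨_, _, ?_, ?_, ⟨_, _, rfl, rfl, hd, ?_⟩, ?_⟩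
    · simp [Function.comp_def]
    · simp [Function.comp_def]
    · simpa [Function.comp_def] using hs'
    · simpa [Function.comp_def] using hs

/-! ### Loops around boxes as automata, and soundness -/

/-- The states reached from `X` in one step of the transition relation `R`, reading `c.1` and
writing `c.2`. -/
def stepSet {A B P : Type u} (R : A × P → B × P → Prop) (X : Set P) (c : A × B) : Set P :=
  {p' | ∃ p ∈ X, R (c.1, p) (c.2, p')}

theorem sem_feedback_box_nil {A B P : Type u} [Finite A] [Finite B] [Finite P]
    (R : A × P → B × P → Prop) (I F : Set P) :
    sem (feedback I F (box R)) [] [] ↔ ∃ p ∈ F, p ∈ I := by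
  simp [sem, shift, and_comm]

/-- The first transition can be absorbed into the set of initial states, which makes induction on
words possible when that set is allowed to vary. -/
theorem sem_feedback_box_cons {A B P : Type u} [Finite A] [Finite B] [Finite P]
    (R : A × P → B × P → Prop) (I F : Set P) (a : A) (b : B) (w : List A) (v : List B) :
    sem (feedback I F (box R)) (a :: w) (b :: v) ↔
      sem (feedback (stepSet R I (a, b)) F (box R)) w v := by
  constructor
  · rintro ⟨x, y, hx, hy, h, q, hq, q', hq', hs⟩
    cases h with
    | nil => simp at hx
    | @cons x₀ y₀ x y h₀ h =>
      obtain ⟨a', p⟩ := x₀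
      obtain ⟨b', p'⟩ := y₀
      simp only [List.map_cons, List.cons.injEq, List.cons_append] at hx hy hs
      obtain ⟨rfl, rfl⟩ := hx
      obtain ⟨rfl, rfl⟩ := hy
      obtain ⟨rfl, hs⟩ := hs
      exact ⟨x, y, rfl, rfl, h, p', ⟨q, hq, h₀⟩, q', hq', hs⟩
  · rintro ⟨x, y, rfl, rfl, h, p', ⟨p, hp, h₀⟩, q', hq', hs⟩
    exact ⟨(a, p) :: x, (b, p') :: y, rfl, rfl, .cons h₀ h, p, hp, q', hq', by simp [hs]⟩

/-- This is correctness of the subset construction: the fold computes the states reachable from `I`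
along `c`. -/
theorem sem_feedback_box_iff {A B P : Type u} [Finite A] [Finite B] [Finite P]
    (R : A × P → B × P → Prop) (I F : Set P) (c : List (A × B)) :
    sem (feedback I F (box R)) (c.map Prod.fst) (c.map Prod.snd) ↔
      ∃ p ∈ F, p ∈ c.foldl (stepSet R) I := by
  induction c generalizing I with
  | nil => exact sem_feedback_box_nil R I F
  | cons c₀ c ih => exact (sem_feedback_box_cons ..).trans (ih _)

/-- By `hstep`, taking the image under `S` commutes with `stepSet`. The image of the current states
is thus preserved letter by letter, and `hfinal` compares acceptance at the end. -/
theorem sem_simulation {A B P Q : Type u} [Finite A] [Finite B] [Finite P] [Finite Q]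
    (R : A × P → B × P → Prop) (I F : Set P) (T : A × Q → B × Q → Prop) (G : Set Q)
    (S : P → Q → Prop)
    (hstep : Relation.Comp R (relProd (fun b b' : B => b = b') S) =
      Relation.Comp (relProd (fun a a' : A => a = a') S) T)
    (hfinal : F = {p | ∃ q ∈ G, S p q}) (w : List A) (v : List B) :
    sem (feedback I F (box R)) w v ↔ sem (feedback {q | ∃ p ∈ I, S p q} G (box T)) w v := by
  induction w generalizing v I with
  | nil =>
    cases v with
    | nil => simp only [sem_feedback_box_nil, hfinal, Set.mem_ofPred_eq]; grind
    | cons b v =>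
      exact iff_of_false (fun h => nomatch length_eq_of_sem _ _ _ h)
        fun h => nomatch length_eq_of_sem _ _ _ h
  | cons a w ih =>
    cases v with
    | nil =>
      exact iff_of_false (fun h => nomatch length_eq_of_sem _ _ _ h)
        fun h => nomatch length_eq_of_sem _ _ _ h
    | cons b v =>
      rw [sem_feedback_box_cons, sem_feedback_box_cons, ih]
      have : {q | ∃ p ∈ stepSet R I (a, b), S p q} = stepSet T {q | ∃ p ∈ I, S p q} (a, b) := by
        ext q
        constructor
        · rintro ⟨p', ⟨p, hp, hR⟩, hS⟩
          have h : Relation.Comp R (relProd (fun b b' : B => b = b') S) (a, p) (b, q) :=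
            ⟨_, hR, rfl, hS⟩
          rw [hstep] at h
          obtain ⟨⟨_, q'⟩, ⟨rfl, hS'⟩, hT⟩ := h
          exact ⟨q', ⟨p, hp, hS'⟩, hT⟩
        · rintro ⟨q', ⟨p, hp, hS⟩, hT⟩
          have h : Relation.Comp (relProd (fun a a' : A => a = a') S) T (a, p) (b, q) :=
            ⟨_, ⟨rfl, hS⟩, hT⟩
          rw [← hstep] at h
          obtain ⟨⟨_, p'⟩, hR, rfl, hS'⟩ := h
          exact ⟨p', ⟨p, hp, hR⟩, hS'⟩
      rw [this]

theorem ProvEq.sound {A B : Type u} {d e : TransDiag A B} (h : ProvEq d e) : d.sem = e.sem := by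
  induction h with
  | refl d => rfl
  | symm _ ih => exact ih.symm
  | trans _ _ ih₁ ih₂ => exact ih₁.trans ih₂
  | comp_congr _ _ ih₁ ih₂ => simp only [sem, ih₁, ih₂]
  | tensor_congr _ _ ih₁ ih₂ => simp only [sem, ih₁, ih₂]
  | feedback_congr I F _ ih => simp only [sem, ih]
  | id_comp d => exact Relation.eq_comp
  | comp_id d => exact Relation.comp_eq
  | comp_assoc d e f => exact Relation.comp_assoc
  | tensor_id A B =>
    funext w v
    exact propext ⟨fun h => List.ext_map_fst_snd h.1 h.2, by rintro rfl; exact ⟨rfl, rfl⟩⟩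
  | tensor_comp d e d' e' =>
    funext w v
    refine propext ⟨?_, ?_⟩
    · rintro ⟨⟨z, h₁, h₂⟩, z', h₁', h₂'⟩
      -- The two intermediate words both have the length of `w`, so they form one word of pairs.
      obtain ⟨z, rfl, rfl⟩ := List.exists_map_fst_snd (w := z) (s := z') (by
        have := length_eq_of_sem _ _ _ h₁
        have := length_eq_of_sem _ _ _ h₁'
        simp_all)
      exact ⟨z, ⟨h₁, h₁'⟩, h₂, h₂'⟩
    · rintro ⟨z, ⟨h₁, h₁'⟩, h₂, h₂'⟩
      exact ⟨⟨_, h₁, h₂⟩, _, h₁', h₂'⟩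
  | tensor_assoc d e f =>
    funext w v
    simp [assoc, sem_comp_iso, sem_iso_comp, sem_tensor, Function.comp_def, and_assoc]
  | unit_tensor d =>
    funext w v
    simp only [leftUnit, sem_comp_iso, sem_iso_comp, sem_tensor, sem_id, eq_iff_iff]
    constructor
    · rintro ⟨-, h⟩
      simpa [Function.comp_def, Equiv.punitProd, Equiv.prodPUnit] using h
    · intro h
      refine ⟨List.ext_getElem ?_ fun _ _ _ => rfl,
        by simpa [Function.comp_def, Equiv.punitProd, Equiv.prodPUnit] using h⟩
      simpa using length_eq_of_sem _ _ _ h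
  | tensor_unit d =>
    funext w v
    simp only [rightUnit, sem_comp_iso, sem_iso_comp, sem_tensor, sem_id, eq_iff_iff]
    constructor
    · rintro ⟨h, -⟩
      simpa [Function.comp_def, Equiv.prodPUnit] using h
    · intro h
      refine ⟨by simpa [Function.comp_def, Equiv.prodPUnit] using h,
        List.ext_getElem ?_ fun _ _ _ => rfl⟩
      simpa using length_eq_of_sem _ _ _ h
  | swap_swap A B =>
    funext w v
    simp [sem, Relation.Comp]
  | swap_natural d e =>
    funext w v
    refine propext ⟨?_, ?_⟩
    · rintro ⟨z, h, rfl⟩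
      exact ⟨_, rfl, by simpa [sem_tensor, Function.comp_def] using h.symm⟩
    · rintro ⟨z, rfl, h⟩
      refine ⟨v.map Prod.swap, ?_, by simp [sem]⟩
      simpa [sem_tensor, Function.comp_def] using h.symm
  | tightening I F d e f => funext w v; exact propext (sem_tightening I F d e f w v)
  | strength I F d => funext w v; exact propext (sem_strength I F d w v)
  | vanishing d => funext w v; exact propext (sem_vanishing d w v)
  | joining I F J G d => funext w v; exact propext (sem_joining I F J G d w v)
  | box_id A => exact List.forall₂_eq_eq_eq
  | box_swap A B => funext w v; exact propext (List.forall₂_graph_iff _ w v)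
  | box_comp R S => funext w v; exact propext (List.forall₂_comp_iff R S w v).symm
  | box_tensor R S => funext w v; exact propext (List.forall₂_relProd_iff R S w v).symm
  | simulation R I F T J G S hinit hstep hfinal =>
    subst hinit
    funext w v
    exact propext (sem_simulation R I F T G S hstep hfinal w v)

/-! ### Reduction to normal form -/

/-- A diagram is stateless if it is provably equal to a box. -/
def IsStateless {A B : Type u} [Finite A] [Finite B] (d : TransDiag A B) : Prop :=
  ∃ R : A → B → Prop, ProvEq d (box R)

namespace IsStateless

theorem box {A B : Type u} [Finite A] [Finite B] (R : A → B → Prop) :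
    IsStateless (TransDiag.box R) :=
  ⟨R, .refl _⟩

theorem id (A : Type u) [Finite A] : IsStateless (TransDiag.id A) :=
  ⟨_, (ProvEq.box_id A).symm⟩

theorem swap (A B : Type u) [Finite A] [Finite B] : IsStateless (TransDiag.swap A B) :=
  ⟨_, (ProvEq.box_swap A B).symm⟩

theorem comp {A B C : Type u} [Finite A] [Finite B] [Finite C]
    {d : TransDiag A B} {e : TransDiag B C} (hd : IsStateless d) (he : IsStateless e) :
    IsStateless (d.comp e) := by
  obtain ⟨R, hR⟩ := hd
  obtain ⟨S, hS⟩ := he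
  exact ⟨_, (ProvEq.comp_congr hR hS).trans (.box_comp R S)⟩

theorem tensor {A B C D : Type u} [Finite A] [Finite B] [Finite C] [Finite D]
    {d : TransDiag A B} {e : TransDiag C D} (hd : IsStateless d) (he : IsStateless e) :
    IsStateless (d.tensor e) := by
  obtain ⟨R, hR⟩ := hd
  obtain ⟨S, hS⟩ := he
  exact ⟨_, (ProvEq.tensor_congr hR hS).trans (.box_tensor R S)⟩

end IsStateless

/-- A diagram has a normal form if it is provably equal to a single feedback loop around a box. -/
def HasNormalForm {A B : Type u} [Finite A] [Finite B] (d : TransDiag A B) : Prop :=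
  ∃ (Q : Type u) (_ : Finite Q) (I F : Set Q) (R : A × Q → B × Q → Prop),
    ProvEq d (feedback I F (box R))

namespace HasNormalForm

theorem of_provEq {A B : Type u} [Finite A] [Finite B] {d e : TransDiag A B}
    (h : ProvEq d e) (he : HasNormalForm e) : HasNormalForm d := by
  obtain ⟨Q, _, I, F, R, hR⟩ := he
  exact ⟨Q, _, I, F, R, h.trans hR⟩

theorem feedback_of_isStateless {A B Q : Type u} [Finite A] [Finite B] [Finite Q] (I F : Set Q)
    {d : TransDiag (A × Q) (B × Q)} (hd : IsStateless d) : HasNormalForm (feedback I F d) := by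
  obtain ⟨R, hR⟩ := hd
  exact ⟨Q, _, I, F, R, .feedback_congr I F hR⟩

/-- Joining merges the two nested loops into one whose states are pairs. -/
theorem feedback {A B Q : Type u} [Finite A] [Finite B] [Finite Q] (I F : Set Q)
    {d : TransDiag (A × Q) (B × Q)} (hd : HasNormalForm d) :
    HasNormalForm (feedback I F d) := by
  obtain ⟨P, _, J, G, R, hR⟩ := hd
  exact of_provEq ((ProvEq.feedback_congr I F hR).trans (.joining I F J G _))
    (feedback_of_isStateless _ _ (((IsStateless.box _).comp (.box _)).comp (.box _)))

/-- Normal forms absorb stateless diagrams on both sides. -/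
theorem stateless_comp_comp {A A' B B' : Type u} [Finite A] [Finite A'] [Finite B] [Finite B']
    {d : TransDiag A' A} {e : TransDiag A B} {f : TransDiag B B'} (hd : IsStateless d)
    (he : HasNormalForm e) (hf : IsStateless f) : HasNormalForm ((d.comp e).comp f) := by
  obtain ⟨Q, _, I, F, R, hR⟩ := he
  exact of_provEq
    ((ProvEq.comp_congr (.comp_congr (.refl _) hR) (.refl _)).trans
      (ProvEq.tightening I F d _ f).symm)
    (feedback_of_isStateless _ _
      (((hd.tensor (.id _)).comp (.box _)).comp (hf.tensor (.id _))))

/-- Vanishing, read backwards, adds a loop with one state. -/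
theorem of_isStateless {A B : Type u} [Finite A] [Finite B] {d : TransDiag A B}
    (hd : IsStateless d) : HasNormalForm d := by
  obtain ⟨R, hR⟩ := hd
  refine of_provEq (hR.trans (.trans ?_ (ProvEq.vanishing
    (TransDiag.box fun (x : A × PUnit.{u + 1}) (y : B × PUnit.{u + 1}) => R x.1 y.1)).symm))
    (feedback_of_isStateless _ _ (.box _))
  refine .symm (.trans (.comp_congr (.box_comp _ _) (.refl _)) (.trans (.box_comp _ _) ?_))
  convert ProvEq.refl (TransDiag.box R) using 2
  funext a b
  simp [Relation.Comp]

theorem id_tensor {A B : Type u} (C : Type u) [Finite A] [Finite B] [Finite C]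
    {d : TransDiag A B} (hd : HasNormalForm d) :
    HasNormalForm (TransDiag.tensor (TransDiag.id C) d) := by
  obtain ⟨Q, _, I, F, R, hR⟩ := hd
  exact of_provEq ((ProvEq.tensor_congr (.refl _) hR).trans (ProvEq.strength I F _).symm)
    (feedback_of_isStateless _ _
      (((IsStateless.box _).comp ((IsStateless.id C).tensor (.box _))).comp (.box _)))

/-- Strength only puts wires on the left; conjugating by swaps moves them to the right. -/
theorem tensor_id {A B : Type u} (C : Type u) [Finite A] [Finite B] [Finite C]
    {d : TransDiag A B} (hd : HasNormalForm d) :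
    HasNormalForm (TransDiag.tensor d (TransDiag.id C)) := by
  refine of_provEq ?_
    (stateless_comp_comp (IsStateless.swap A C) (id_tensor C hd) (IsStateless.swap C B))
  exact .symm <| .trans (.comp_congr (ProvEq.swap_natural d (TransDiag.id C)).symm (.refl _)) <|
    .trans (.comp_assoc _ _ _) <| .trans (.comp_congr (.refl _) (.swap_swap _ _)) (.comp_id _)

/-- Tightening widens the loop of `e` to enclose `d`. What remains inside is `d` beside a wire,
followed by a box: a normal form again, so two nested loops are left to join. -/
theorem comp {A B C : Type u} [Finite A] [Finite B] [Finite C]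
    {d : TransDiag A B} {e : TransDiag B C} (hd : HasNormalForm d) (he : HasNormalForm e) :
    HasNormalForm (d.comp e) := by
  obtain ⟨Q, _, I, F, S, hS⟩ := he
  have h : HasNormalForm (TransDiag.comp (TransDiag.comp (TransDiag.id _)
      (TransDiag.tensor d (TransDiag.id Q)))
      (TransDiag.comp (TransDiag.box S) (TransDiag.tensor (TransDiag.id C) (TransDiag.id Q)))) :=
    stateless_comp_comp (.id _) (hd.tensor_id Q)
      ((IsStateless.box S).comp ((IsStateless.id _).tensor (.id _)))
  refine of_provEq ?_ (h.feedback I F)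
  refine (ProvEq.comp_congr (.refl _) hS).trans ((ProvEq.comp_id _).symm.trans
    ((ProvEq.tightening I F d (TransDiag.box S) (TransDiag.id C)).symm.trans
      (.feedback_congr I F ?_)))
  exact (ProvEq.comp_assoc _ _ _).trans (.comp_congr (ProvEq.id_comp _).symm (.refl _))

theorem tensor {A B C D : Type u} [Finite A] [Finite B] [Finite C] [Finite D]
    {d : TransDiag A B} {e : TransDiag C D} (hd : HasNormalForm d) (he : HasNormalForm e) :
    HasNormalForm (d.tensor e) :=
  of_provEq
    ((ProvEq.tensor_congr (ProvEq.comp_id d).symm (ProvEq.id_comp e).symm).trans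
      (.tensor_comp _ _ _ _))
    ((hd.tensor_id C).comp (he.id_tensor B))

end HasNormalForm

theorem hasNormalForm {A B : Type u} (d : TransDiag A B) :
    ∀ [Finite A] [Finite B], HasNormalForm d := by
  induction d with
  | box R => intros; exact HasNormalForm.of_isStateless (.box R)
  | id A => intros; exact HasNormalForm.of_isStateless (.id A)
  | swap A B => intros; exact HasNormalForm.of_isStateless (.swap A B)
  | comp d e ihd ihe => intros; exact HasNormalForm.comp ihd ihe
  | tensor d e ihd ihe => intros; exact HasNormalForm.tensor ihd ihe
  | feedback I F d ih => intros; exact HasNormalForm.feedback I F ih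

/-! ### Determinisation and comparison of normal forms -/

/-- A deterministic automaton with states `Z` and a map `X` to the subset automaton of `R` that
preserves initial states and transitions simulates `R` by the relation `p ∈ X z`. -/
theorem provEq_of_deterministic {A B P Z : Type u} [Finite A] [Finite B] [Finite P] [Finite Z]
    (R : A × P → B × P → Prop) (I F : Set P) (z₀ : Z) (step : Z → A × B → Z) (X : Z → Set P)
    (hinit : X z₀ = I) (hstep : ∀ z c, X (step z c) = stepSet R (X z) c) :
    ProvEq
      (feedback {z₀} {z | ∃ p ∈ F, p ∈ X z}
        (box fun (x : A × Z) (y : B × Z) => y.2 = step x.2 (x.1, y.1)))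
      (feedback I F (box R)) := by
  refine .simulation _ _ _ _ _ _ (fun z p => p ∈ X z) ?_ ?_ rfl
  · simp [hinit]
  -- Both composites say that `p` lies in `stepSet R (X z) (a, b)`: one through the unique successor
  -- of `z`, the other by choosing a predecessor of `p` in `X z`.
  · funext ⟨a, z⟩ ⟨b, p⟩
    refine propext ⟨?_, ?_⟩
    · rintro ⟨⟨b', z'⟩, h, rfl, hp⟩
      obtain rfl : z' = step z (a, b') := h
      have hp : p ∈ X (step z (a, b')) := hp
      rw [hstep] at hp
      obtain ⟨p', hp', hR⟩ := hp
      exact ⟨(a, p'), ⟨rfl, hp'⟩, hR⟩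
    · rintro ⟨⟨a', p'⟩, ⟨rfl, hp'⟩, hR⟩
      refine ⟨(b, step z (a, b)), rfl, rfl, ?_⟩
      change p ∈ X (step z (a, b))
      rw [hstep]
      exact ⟨p', hp', hR⟩

theorem provEq_feedback_box {A B P Q : Type u} [Finite A] [Finite B] [Finite P] [Finite Q]
    (R : A × P → B × P → Prop) (I F : Set P) (T : A × Q → B × Q → Prop) (J G : Set Q)
    (h : sem (feedback I F (box R)) = sem (feedback J G (box T))) :
    ProvEq (feedback I F (box R)) (feedback J G (box T)) := by
  -- Reachability is essential: on other pairs of subsets the two acceptance conditions may differ.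
  let Z : Type u := {z : Set P × Set Q //
    ∃ c : List (A × B), z = (c.foldl (stepSet R) I, c.foldl (stepSet T) J)}
  let step : Z → A × B → Z := fun z c =>
    ⟨(stepSet R z.1.1 c, stepSet T z.1.2 c), by
      obtain ⟨_, cs, rfl⟩ := z
      exact ⟨cs ++ [c], by simp⟩⟩
  let z₀ : Z := ⟨(I, J), [], rfl⟩
  have hR := provEq_of_deterministic R I F z₀ step (fun z => z.1.1) rfl fun _ _ => rfl
  have hT := provEq_of_deterministic T J G z₀ step (fun z => z.1.2) rfl fun _ _ => rfl
  have hfinal : {z : Z | ∃ p ∈ F, p ∈ z.1.1} = {z : Z | ∃ q ∈ G, q ∈ z.1.2} := by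
    -- At the pair reached by `c`, each condition says that its loop relates the two projections of
    -- `c`, and the two semantics agree.
    ext ⟨_, c, rfl⟩
    exact (sem_feedback_box_iff R I F c).symm.trans (h ▸ sem_feedback_box_iff T J G c)
  exact hR.symm.trans (hfinal ▸ hT)

end TransDiag

theorem mainTheorem2 {A B : Type u} [Finite A] [Finite B] (d e : TransDiag A B)
    (h : d.sem = e.sem) : TransDiag.ProvEq d e := by
  obtain ⟨P, _, I, F, R, hR⟩ := d.hasNormalForm
  obtain ⟨Q, _, J, G, T, hT⟩ := e.hasNormalForm
  exact hR.trans ((TransDiag.provEq_feedback_box R I F T J G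
    (hR.sound.symm.trans (h.trans hT.sound))).trans hT.symm)
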